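/- Let $\mathcal F$ be a nonempty compact convex subset of a real topological vector space, let $\mathcal Z$ be a nonempty compact Hausdorff space with its Borel $\sigma$-algebra, and let $\ell:\mathcal Z\times\mathcal F\to\mathbb R$ be (jointly) continuous, hence bounded, with $\ell(z,\cdot)$ convex for every $z\in\mathcal Z$. For $T\ge 0$ define the minimax regret of the $T$-round online convex optimization game by $$\mathrm{Reg}_T=\inf_{f_1\in\mathcal F}\sup_{z_1\in\mathcal Z}\cdots\inf_{f_T\in\mathcal F}\sup_{z_T\in\mathcal Z}\Big(\sum_{t=1}^T\ell(z_t,f_t)-\inf_{f\in\mathcal F}\sum_{t=1}^T\ell(z_t,f)\Big).$$ Then $$\mathrm{Reg}_T=\sup_{\mathbf p}\ \mathbb E\Big[\sum_{t=1}^T\inf_{f_t\in\mathcal F}\mathbb E\big[\ell(Z_t,f_t)\,\big|\,Z_1,\dots,Z_{t-1}\big]-\inf_{f\in\mathcal F}\sum_{t=1}^T\ell(Z_t,f)\Big],$$ where the supremum is over all joint probability distributions $\mathbf p$ on $\mathcal Z^T$ (with the product $\sigma$-algebra), and $(Z_1,\dots,Z_T)$ has law $\mathbf p$. Moreover the random variable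 inside the outer expectation is integrable for every $\mathbf p$. Here the conditional expectations $\mathbb E[\ell(Z_t,f)\mid Z_1,\dots,Z_{t-1}]$, $f\in\mathcal F$, are taken simultaneously in $f$, as the values at $f$ of the conditional expectation of the $C(\mathcal F)$-valued random variable $\ell(Z_t,\cdot)$; when $\mathcal Z$ is metrizable this is the integral of $\ell(\cdot,f)$ against the regular conditional distribution of $Z_t$ given $Z_1,\dots,Z_{t-1}$. -/

import Mathlib

open MeasureTheory ProbabilityTheory

section OnlineConvexOptimization

variable {Z E : Type*} (F : Set E) (ℓ : Z → E → ℝ)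

/-- The regret `∑ₜ ℓ(zₜ, fₜ) - inf_{f ∈ F} ∑ₜ ℓ(zₜ, f)` of a play of `T` rounds. -/
noncomputable def regret {T : ℕ} (z : Fin T → Z) (f : Fin T → F) : ℝ :=
  ∑ t, ℓ (z t) (f t) - ⨅ g : F, ∑ t, ℓ (z t) g

/-- The iterated value `inf_{f₁ ∈ F} sup_{z₁} ⋯ inf_{f_T ∈ F} sup_{z_T} φ(z, f)` of the `T`-round
game with payoff `φ`; the outermost pair belongs to the first round. -/
noncomputable def iteratedInfSup : (T : ℕ) → ((Fin T → Z) → (Fin T → F) → ℝ) → ℝ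
  | 0, φ => φ Fin.elim0 Fin.elim0
  | T + 1, φ =>
      ⨅ f₁ : F, ⨆ z₁ : Z,
        iteratedInfSup T fun z f => φ (Fin.cons z₁ z) (Fin.cons f₁ f)

/-- The minimax regret (the value of the `T`-round online convex optimization game). -/
noncomputable def minimaxRegret (T : ℕ) : ℝ :=
  iteratedInfSup F T (regret F ℓ)

/-- The σ-algebra on `Z^T` generated by the coordinates strictly before `t`. -/
abbrev pastSigma (Z : Type*) [MeasurableSpace Z] {T : ℕ} (t : Fin T) : MeasurableSpace (Fin T → Z) :=
  MeasurableSpace.comap (fun (z : Fin T → Z) (i : Set.Iio t) => z i) inferInstance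

variable [TopologicalSpace Z] [TopologicalSpace E]

/-- The loss of the move `z`, as a continuous function `ℓ(z, ·)` on `F`. -/
def lossFun {F : Set E} {ℓ : Z → E → ℝ}
    (hℓ : ContinuousOn (Function.uncurry ℓ) (Set.univ ×ˢ F)) (z : Z) : C(F, ℝ) where
  toFun f := ℓ z f
  continuous_toFun :=
    hℓ.comp_continuous (f := fun f : F => (z, (f : E))) (by fun_prop) fun f => ⟨trivial, f.2⟩

theorem continuous_lossFun {F : Set E} {ℓ : Z → E → ℝ}
    (hℓ : ContinuousOn (Function.uncurry ℓ) (Set.univ ×ˢ F)) : Continuous (lossFun hℓ) :=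
  ContinuousMap.continuous_of_continuous_uncurry _ <|
    hℓ.comp_continuous (f := fun q : Z × F => (q.1, (q.2 : E))) (by fun_prop)
      fun q => ⟨trivial, q.2.2⟩

variable [MeasurableSpace Z] {F} {ℓ} [CompactSpace F] {T : ℕ}

/-- `f ↦ E[ℓ(Z_t, f) | Z_1, …, Z_{t-1}]`, simultaneously for all `f ∈ F`. A scalar conditional
expectation is only defined up to a null set that depends on `f`, so that an infimum over
uncountably many `f` needs versions that fit together: we condition the random continuous function
`ℓ(Z_t, ·)`, which takes values in the Banach space `C(F, ℝ)`. The value at `f` is then a version of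
`E[ℓ(Z_t, f) | Z_1, …, Z_{t-1}]` (`conditionalLoss_apply`), and it is the integral of `ℓ(·, f)`
against the regular conditional distribution of `Z_t` given the past whenever `Z` is standard Borel
(`conditionalLoss_eq_integral_condDistrib`). -/
noncomputable def conditionalLoss (hℓ : ContinuousOn (Function.uncurry ℓ) (Set.univ ×ˢ F))
    (p : Measure (Fin T → Z)) (t : Fin T) : (Fin T → Z) → C(F, ℝ) :=
  p[fun z => lossFun hℓ (z t) | pastSigma Z t]

/-- `∑ₜ inf_{fₜ ∈ F} E[ℓ(Z_t, fₜ) | Z_1, …, Z_{t-1}] - inf_{f ∈ F} ∑ₜ ℓ(Z_t, f)`, as a random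
variable on `Z^T` under the joint distribution `p`. -/
noncomputable def stochasticRegret (hℓ : ContinuousOn (Function.uncurry ℓ) (Set.univ ×ˢ F))
    (p : Measure (Fin T → Z)) (z : Fin T → Z) : ℝ :=
  ∑ t, (⨅ f : F, conditionalLoss hℓ p t z f) - ⨅ f : F, ∑ t, ℓ (z t) f

theorem stronglyMeasurable_lossFun [CompactSpace Z] [BorelSpace Z]
    (hℓ : ContinuousOn (Function.uncurry ℓ) (Set.univ ×ˢ F)) :
    StronglyMeasurable (lossFun hℓ) := by
  borelize C(F, ℝ)
  exact stronglyMeasurable_iff_measurable_separable.2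
    ⟨(continuous_lossFun hℓ).measurable,
      (isCompact_range (continuous_lossFun hℓ)).isSeparable⟩

theorem integrable_lossFun [CompactSpace Z] [BorelSpace Z]
    (hℓ : ContinuousOn (Function.uncurry ℓ) (Set.univ ×ˢ F))
    (p : Measure (Fin T → Z)) [IsProbabilityMeasure p] (t : Fin T) :
    Integrable (fun z => lossFun hℓ (z t)) p := by
  obtain ⟨C, hC⟩ := (isCompact_range (continuous_lossFun hℓ)).isBounded.exists_norm_le
  refine Integrable.of_bound
    ((stronglyMeasurable_lossFun hℓ).comp_measurable (measurable_pi_apply t)).aestronglyMeasurable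
    C (ae_of_all _ fun z => hC _ ⟨z t, rfl⟩)

theorem conditionalLoss_apply [CompactSpace Z] [BorelSpace Z]
    (hℓ : ContinuousOn (Function.uncurry ℓ) (Set.univ ×ˢ F))
    (p : Measure (Fin T → Z)) [IsProbabilityMeasure p] (t : Fin T) (f : F) :
    (fun z => conditionalLoss hℓ p t z f) =ᵐ[p] p[fun z => ℓ (z t) f | pastSigma Z t] :=
  (ContinuousMap.evalCLM ℝ f).comp_condExp_comm (integrable_lossFun hℓ p t)

theorem conditionalLoss_eq_integral_condDistrib [CompactSpace Z] [BorelSpace Z]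
    [StandardBorelSpace Z] [Nonempty Z]
    (hℓ : ContinuousOn (Function.uncurry ℓ) (Set.univ ×ˢ F))
    (p : Measure (Fin T → Z)) [IsProbabilityMeasure p] (t : Fin T) :
    ∀ᵐ z ∂p, ∀ f : F, conditionalLoss hℓ p t z f =
      ∫ y, ℓ y f ∂(condDistrib (fun z : Fin T → Z => z t)
        (fun (z : Fin T → Z) (i : Set.Iio t) => z i) p (fun i => z i)) := by
  have hX : Measurable fun (z : Fin T → Z) (i : Set.Iio t) => z i := by fun_prop
  filter_upwards [condExp_ae_eq_integral_condDistrib hX (measurable_pi_apply t).aemeasurable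
    (stronglyMeasurable_lossFun hℓ) (integrable_lossFun hℓ p t)] with z hz f
  obtain ⟨C, hC⟩ := (isCompact_range (continuous_lossFun hℓ)).isBounded.exists_norm_le
  have hint : Integrable (lossFun hℓ) (condDistrib (fun z : Fin T → Z => z t)
      (fun (z : Fin T → Z) (i : Set.Iio t) => z i) p (fun i => z i)) :=
    Integrable.of_bound (stronglyMeasurable_lossFun hℓ).aestronglyMeasurable C
      (ae_of_all _ fun y => hC _ ⟨y, rfl⟩)
  have h := congrArg (ContinuousMap.evalCLM ℝ f) hz
  rw [← (ContinuousMap.evalCLM ℝ f).integral_comp_comm hint] at h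
  exact h

end OnlineConvexOptimization

/-! ### Backward induction: the value of the game as a function of past moves -/

section BackwardInduction

open Function

/-! Backward induction on the payoff `-inf_f ∑ ℓ(z_t, f)` gives values `W_i` depending only on the
moves before `i`, with `W_0` the minimax regret. Under a law `p`, everything reduces to comparing,
for each round, `E[W_t - W_{t+1}]` with `E[inf_f E[ℓ(Z_t, f) | past]]`, and then telescoping.

For every `p` the second quantity is at most the first: an average over `Z_t` given the past is at
most a supremum over `z_t` (`integral_infValue_condExp_add_le`). This half needs no convexity.

Conversely, convexity and a finite minimax theorem, proved by separation, turn the `inf sup` of a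
round into a mixed move on a finite net of `Z`, with small loss (`exists_mixed_move`). Playing these
moves in turn builds a nearly optimal law whose conditional losses are explicit (`condExp_playLaw`).

Since `Z` need not be metrizable, topology and measurability on `Z^T` pass through the compact
metric space of loss functions in `C(F, ℝ)`. All the `W_i` are Lipschitz for the loss distance
(`LossLipschitz`), which makes them bounded, measurable for the product σ-algebra, and stable under
rounding moves to a net. -/

variable {Z X : Type*} [TopologicalSpace X] {T : ℕ}

/-- The worst case over the move of round `t`, given the move `x` of the learner. -/
noncomputable def roundSup (k : Z → C(X, ℝ)) (t : Fin T) (ψ : (Fin T → Z) → ℝ) (x : X)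
    (z : Fin T → Z) : ℝ :=
  ⨆ y, (k y x + ψ (update z t y))

/-- The value of round `t` with continuation value `ψ`. -/
noncomputable def roundValue (k : Z → C(X, ℝ)) (t : Fin T) (ψ : (Fin T → Z) → ℝ)
    (z : Fin T → Z) : ℝ :=
  ⨅ x, roundSup k t ψ x z

/-- The value of the game from round `i` on, as a function of the moves, with final payoff `φ`. -/
noncomputable def continuationValue (k : Z → C(X, ℝ)) (φ : (Fin T → Z) → ℝ) :
    Fin (T + 1) → (Fin T → Z) → ℝ :=
  Fin.reverseInduction φ fun t ψ => roundValue k t ψ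

@[simp]
theorem continuationValue_last (k : Z → C(X, ℝ)) (φ : (Fin T → Z) → ℝ) :
    continuationValue k φ (Fin.last T) = φ := by
  simp [continuationValue]

@[simp]
theorem continuationValue_castSucc (k : Z → C(X, ℝ)) (φ : (Fin T → Z) → ℝ) (t : Fin T) :
    continuationValue k φ t.castSucc = roundValue k t (continuationValue k φ t.succ) := by
  simp [continuationValue]

theorem roundSup_update (k : Z → C(X, ℝ)) (t : Fin T) (x : X)
    {ψ : (Fin T → Z) → ℝ}
    {s : Fin T} (hψ : t < s → ∀ z y, ψ (update z s y) = ψ z) (hs : t ≤ s) (z : Fin T → Z) (y : Z) :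
    roundSup k t ψ x (update z s y) = roundSup k t ψ x z := by
  unfold roundSup
  rcases hs.eq_or_lt with rfl | h
  · simp
  · refine iSup_congr fun y' => ?_
    rw [update_comm h.ne', hψ h]

/-- Each round overwrites its own coordinate, so backward induction forgets the coordinates one by
one. Histories can therefore be kept as full sequences with arbitrary entries in the rounds not yet
played. -/
theorem continuationValue_update (k : Z → C(X, ℝ)) (φ : (Fin T → Z) → ℝ) (i : Fin (T + 1)) :
    ∀ s : Fin T, i ≤ s.castSucc → ∀ (z : Fin T → Z) (y : Z),
      continuationValue k φ i (update z s y) = continuationValue k φ i z := by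
  induction i using Fin.reverseInduction with
  | last => intro s hs; exact absurd hs (not_le.2 (Fin.castSucc_lt_last s))
  | cast t ih =>
    intro s hs z y
    simp only [continuationValue_castSucc]
    exact iInf_congr fun x =>
      roundSup_update k t x (fun h => ih s (Fin.succ_le_castSucc_iff.2 h))
        (Fin.castSucc_le_castSucc_iff.1 hs) z y

theorem continuationValue_cons (k : Z → C(X, ℝ)) (φ : (Fin (T + 1) → Z) → ℝ) (y : Z)
    (i : Fin (T + 1)) (z : Fin T → Z) :
    continuationValue k φ i.succ (Fin.cons y z : Fin (T + 1) → Z) =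
      continuationValue k (fun w => φ (Fin.cons y w)) i z := by
  induction i using Fin.reverseInduction generalizing z with
  | last => simp
  | cast t ih =>
    rw [Fin.succ_castSucc, continuationValue_castSucc, continuationValue_castSucc]
    simp only [roundValue, roundSup]
    refine iInf_congr fun x => iSup_congr fun y' => ?_
    rw [← ih, Fin.cons_update]

variable [CompactSpace X]

/-- A function of a sequence of moves that is 1-Lipschitz for the sum of the distances between the
losses of the moves. -/
def LossLipschitz (k : Z → C(X, ℝ)) (ψ : (Fin T → Z) → ℝ) : Prop :=
  ∀ z w, ψ z ≤ ψ w + ∑ t, ‖k (z t) - k (w t)‖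

variable {k : Z → C(X, ℝ)} {C : ℝ} {ψ : (Fin T → Z) → ℝ}

theorem sum_norm_update_sub_update_le (k : Z → C(X, ℝ)) (z w : Fin T → Z) (t : Fin T) (y : Z) :
    ∑ s, ‖k (update z t y s) - k (update w t y s)‖ ≤ ∑ s, ‖k (z s) - k (w s)‖ := by
  refine Finset.sum_le_sum fun s _ => ?_
  rcases eq_or_ne s t with rfl | h
  · simp
  · simp [h]

theorem sum_norm_update_sub_update_eq (k : Z → C(X, ℝ)) (z : Fin T → Z) (t : Fin T) (y y' : Z) :
    ∑ s, ‖k (update z t y s) - k (update z t y' s)‖ = ‖k y - k y'‖ := by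
  rw [Finset.sum_eq_single t]
  · simp
  · intro s _ h
    simp [h]
  · simp

/-- Boundedness ensures that the real suprema and infima of the game are genuine rather than junk
values. -/
theorem LossLipschitz.exists_bound [Nonempty Z] (hψ : LossLipschitz k ψ)
    (hC : ∀ z, ‖k z‖ ≤ C) : ∃ B, ∀ z, |ψ z| ≤ B := by
  obtain ⟨y⟩ := ‹Nonempty Z›
  have hD : ∀ z w : Fin T → Z, ∑ t, ‖k (z t) - k (w t)‖ ≤ T * (C + C) := fun z w => by
    calc ∑ t, ‖k (z t) - k (w t)‖ ≤ ∑ _t : Fin T, (C + C) :=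
          Finset.sum_le_sum fun t _ => (norm_sub_le _ _).trans (add_le_add (hC _) (hC _))
      _ = T * (C + C) := by simp [mul_add]
  refine ⟨|ψ fun _ => y| + T * (C + C), fun z => abs_le.2 ⟨?_, ?_⟩⟩
  · have := hψ (fun _ => y) z
    have := hD (fun _ => y) z
    have := neg_abs_le (ψ fun _ => y)
    linarith
  · have := hψ z (fun _ => y)
    have := hD z (fun _ => y)
    have := le_abs_self (ψ fun _ => y)
    linarith

theorem bddAbove_roundSup [Nonempty Z] (hψ : LossLipschitz k ψ) (hC : ∀ z, ‖k z‖ ≤ C)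
    (t : Fin T) (x : X) (z : Fin T → Z) :
    BddAbove (Set.range fun y => k y x + ψ (update z t y)) := by
  obtain ⟨B, hB⟩ := hψ.exists_bound hC
  refine ⟨C + B, ?_⟩
  rintro _ ⟨y, rfl⟩
  exact add_le_add (((le_abs_self _).trans ((k y).norm_coe_le_norm x)).trans (hC y))
    ((le_abs_self _).trans (hB _))

theorem le_roundSup [Nonempty Z] (hψ : LossLipschitz k ψ) (hC : ∀ z, ‖k z‖ ≤ C)
    (t : Fin T) (x : X) (z : Fin T → Z) (y : Z) :
    k y x + ψ (update z t y) ≤ roundSup k t ψ x z :=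
  le_ciSup (bddAbove_roundSup hψ hC t x z) y

theorem bddBelow_roundValue [Nonempty Z] (hψ : LossLipschitz k ψ) (hC : ∀ z, ‖k z‖ ≤ C)
    (t : Fin T) (z : Fin T → Z) : BddBelow (Set.range fun x => roundSup k t ψ x z) := by
  obtain ⟨B, hB⟩ := hψ.exists_bound hC
  obtain ⟨y⟩ := ‹Nonempty Z›
  refine ⟨-C + -B, ?_⟩
  rintro _ ⟨x, rfl⟩
  refine le_trans (add_le_add ?_ ?_) (le_roundSup hψ hC t x z y)
  · exact neg_le_of_abs_le (((k y).norm_coe_le_norm x).trans (hC y))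
  · exact neg_le_of_abs_le (hB _)

theorem roundValue_le_roundSup [Nonempty Z] (hψ : LossLipschitz k ψ) (hC : ∀ z, ‖k z‖ ≤ C)
    (t : Fin T) (x : X) (z : Fin T → Z) : roundValue k t ψ z ≤ roundSup k t ψ x z :=
  ciInf_le (bddBelow_roundValue hψ hC t z) x

theorem LossLipschitz.roundSup [Nonempty Z] (hψ : LossLipschitz k ψ) (hC : ∀ z, ‖k z‖ ≤ C)
    (t : Fin T) (x : X) : LossLipschitz k (roundSup k t ψ x) := fun z w => by
  refine ciSup_le fun y => ?_
  have h1 := hψ (update z t y) (update w t y)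
  have h2 := sum_norm_update_sub_update_le k z w t y
  have h3 := le_roundSup hψ hC t x w y
  linarith

theorem LossLipschitz.roundValue [Nonempty Z] [Nonempty X] (hψ : LossLipschitz k ψ)
    (hC : ∀ z, ‖k z‖ ≤ C) (t : Fin T) : LossLipschitz k (roundValue k t ψ) := fun z w => by
  rw [← sub_le_iff_le_add]
  refine le_ciInf fun x => ?_
  have h1 := roundValue_le_roundSup hψ hC t x z
  have h2 := hψ.roundSup hC t x z w
  linarith

theorem LossLipschitz.continuationValue [Nonempty Z] [Nonempty X] {φ : (Fin T → Z) → ℝ}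
    (hφ : LossLipschitz k φ) (hC : ∀ z, ‖k z‖ ≤ C) (i : Fin (T + 1)) :
    LossLipschitz k (continuationValue k φ i) := by
  induction i using Fin.reverseInduction with
  | last => simpa using hφ
  | cast t ih => simpa using ih.roundValue hC t

theorem LossLipschitz.cons {φ : (Fin (T + 1) → Z) → ℝ} (hφ : LossLipschitz k φ) (y : Z) :
    LossLipschitz k fun z : Fin T → Z => φ (Fin.cons y z) := fun z w => by
  simpa [Fin.sum_univ_succ] using hφ (Fin.cons y z) (Fin.cons y w)

/-- A function that is determined by the coordinates before `i` agrees on sequences that have the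
same coordinates before `i`. -/
theorem eq_of_forall_update_eq {α : Type*} {g : (Fin T → Z) → α} {p : Fin T → Prop}
    (hg : ∀ s, p s → ∀ z y, g (update z s y) = g z) {z w : Fin T → Z}
    (h : ∀ s, ¬ p s → z s = w s) : g z = g w := by
  classical
  -- Pass from `w` to `z` by changing one irrelevant coordinate at a time.
  have key : ∀ A : Finset (Fin T), (∀ s ∈ A, p s) → g (A.piecewise z w) = g w := by
    intro A
    induction A using Finset.induction with
    | empty => simp
    | insert s A hs ih =>
      intro hA
      rw [Finset.piecewise_insert, hg s (hA s (by simp)),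
        ih fun s' hs' => hA s' (Finset.mem_insert_of_mem hs')]
  rw [← key (Finset.univ.filter p) (by simp)]
  congr 1
  ext s
  by_cases hs : p s
  · simp [hs]
  · simp [hs, h s hs]

end BackwardInduction

/-! ### The iterated value equals the backward induction value -/

section LinkToIterated

variable {Z E : Type*} [TopologicalSpace E] {F : Set E} [CompactSpace F] {k : Z → C(F, ℝ)} {C : ℝ}

/-- Translation by a constant commutes with bounded infima and suprema. The constant `c` accumulates
the losses already incurred, which lets the induction run over the first round. -/
theorem iteratedInfSup_eq_continuationValue [Nonempty Z] [Nonempty F] (hC : ∀ z, ‖k z‖ ≤ C)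
    {T : ℕ} (φ : (Fin T → Z) → ℝ) (hφ : LossLipschitz k φ) (c : ℝ) (z₀ : Fin T → Z) :
    iteratedInfSup F T (fun z f => c + ∑ t, k (z t) (f t) + φ z) =
      c + continuationValue k φ 0 z₀ := by
  induction T generalizing c with
  | zero =>
    have h : continuationValue k φ 0 = φ := continuationValue_last k φ
    rw [h, iteratedInfSup, Subsingleton.elim z₀ Fin.elim0]
    simp
  | succ T ih =>
    have hψ := hφ.continuationValue hC (Fin.succ 0)
    have h0 : continuationValue k φ 0 = _ := continuationValue_castSucc k φ 0
    rw [h0, iteratedInfSup, roundValue,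
      show c + (⨅ x, roundSup k 0 (continuationValue k φ (Fin.succ 0)) x z₀) =
        OrderIso.addLeft c (⨅ x, roundSup k 0 (continuationValue k φ (Fin.succ 0)) x z₀) from rfl,
      OrderIso.map_ciInf _ (bddBelow_roundValue hψ hC 0 z₀)]
    refine iInf_congr fun x => ?_
    rw [roundSup, OrderIso.map_ciSup _ (bddAbove_roundSup hψ hC 0 x z₀)]
    refine iSup_congr fun y => ?_
    have h1 : Function.update z₀ 0 y = Fin.cons y (Fin.tail z₀) := by
      rw [← Fin.cons_self_tail z₀, Fin.update_cons_zero]; simp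
    rw [h1, continuationValue_cons, OrderIso.addLeft_apply, ← add_assoc,
      ← ih _ (hφ.cons y) (c + k y x) (Fin.tail z₀)]
    congr 1
    ext z f
    simp [Fin.sum_univ_succ, add_assoc]

end LinkToIterated

/-! ### A finite minimax theorem and mixed moves -/

section Minimax

open Function

/-- Weak minimax theorem for finitely many convexlike functions. -/
theorem exists_stdSimplex_ciInf_le {ι X : Type*} [Fintype ι] [Nonempty ι] [Nonempty X]
    (g : ι → X → ℝ)
    (hg : ∀ x y : X, ∀ a b : ℝ, 0 ≤ a → 0 ≤ b → a + b = 1 →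
      ∃ w, ∀ i, g i w ≤ a * g i x + b * g i y)
    (v : ℝ) (hv : ∀ x, ∃ i, v ≤ g i x) :
    ∃ q ∈ stdSimplex ℝ ι, ∀ x, v ≤ ∑ i, q i * g i x := by
  classical
  -- The upward closure of the values is convex and misses the open orthant below `v`; the
  -- normalized normal vector of a separating hyperplane is the required `q`.
  let A : Set (ι → ℝ) := {u | ∃ x, ∀ i, g i x ≤ u i}
  let B : Set (ι → ℝ) := Set.univ.pi fun _ => Set.Iio v
  have hA : Convex ℝ A := by
    rintro u ⟨x, hx⟩ u' ⟨y, hy⟩ a b ha hb hab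
    obtain ⟨w, hw⟩ := hg x y a b ha hb hab
    refine ⟨w, fun i => (hw i).trans ?_⟩
    simp only [Pi.add_apply, Pi.smul_apply, smul_eq_mul]
    exact add_le_add (mul_le_mul_of_nonneg_left (hx i) ha) (mul_le_mul_of_nonneg_left (hy i) hb)
  have hB : Convex ℝ B := convex_pi fun _ _ => convex_Iio _
  have hBo : IsOpen B := isOpen_set_pi Set.finite_univ fun _ _ => isOpen_Iio
  have hdisj : Disjoint B A := by
    rw [Set.disjoint_left]
    rintro u hu ⟨x, hx⟩
    obtain ⟨i, hi⟩ := hv x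
    exact absurd (hi.trans (hx i)) (not_le.2 (hu i trivial))
  obtain ⟨L, c, hLB, hLA⟩ := geometric_hahn_banach_open hB hBo hA hdisj
  let l : ι → ℝ := fun i => L (Pi.single i 1)
  have hL : ∀ u, L u = ∑ i, u i * l i := fun u => by
    conv_lhs => rw [pi_eq_sum_univ' u]
    simp [l, map_sum]
  obtain ⟨x₀⟩ := ‹Nonempty X›
  have hl : ∀ i, 0 ≤ l i := by
    intro i
    by_contra! h
    -- Raising coordinate `i` by `r` stays in `A`, but a negative `l i` would push `L` down to at
    -- most `c - 1`.
    let r : ℝ := max 0 ((L (fun j => g j x₀) - c + 1) / (- l i))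
    have h1 := hLA ((fun j => g j x₀) + Pi.single i r) ⟨x₀, fun j => by
      simp only [Pi.add_apply, le_add_iff_nonneg_right]
      by_cases hj : j = i
      · subst hj; simp [r]
      · simp [hj]⟩
    have h2 : L (Pi.single i r) = r * l i := by
      rw [hL, Finset.sum_eq_single i] <;> simp +contextual
    rw [map_add, h2] at h1
    have h3 : (L (fun j => g j x₀) - c + 1) / (- l i) ≤ r := le_max_right _ _
    rw [div_le_iff₀ (by linarith)] at h3
    linarith
  -- The corner `v` lies only on the boundary of `B`, so it is approached from inside.
  have hvB : ∀ ε > 0, (v - ε) * ∑ i, l i < c := fun ε hε => by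
    have := hLB (fun _ => v - ε) fun i _ => by simp [hε]
    rwa [hL, ← Finset.mul_sum] at this
  have hpos : 0 < ∑ i, l i := by
    refine (Finset.sum_nonneg fun i _ => hl i).lt_of_ne' fun h => ?_
    have h0 : ∀ i, l i = 0 := fun i =>
      (Finset.sum_eq_zero_iff_of_nonneg fun i _ => hl i).1 h i (Finset.mem_univ i)
    have h1 := hLA (fun j => g j x₀) ⟨x₀, fun _ => le_rfl⟩
    have h2 := hvB 1 one_pos
    rw [h, mul_zero] at h2
    rw [hL] at h1
    simp [h0] at h1
    linarith
  refine ⟨fun i => l i / ∑ j, l j, ⟨fun i => div_nonneg (hl i) hpos.le, ?_⟩, fun x => ?_⟩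
  · rw [← Finset.sum_div, div_self hpos.ne']
  · have h1 : c ≤ ∑ i, g i x * l i := by
      rw [← hL]
      exact hLA _ ⟨x, fun _ => le_rfl⟩
    have h2 : ∑ i, l i / (∑ j, l j) * g i x = (∑ i, g i x * l i) / ∑ j, l j := by
      rw [Finset.sum_div]
      exact Finset.sum_congr rfl fun i _ => by ring
    rw [h2]
    refine le_of_forall_pos_le_add fun ε hε => ?_
    rw [← sub_le_iff_le_add, le_div_iff₀ hpos]
    exact (hvB ε hε).le.trans h1

variable {Z X : Type*} [TopologicalSpace X] [CompactSpace X] {T : ℕ}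
variable {k : Z → C(X, ℝ)} {C : ℝ} {ψ : (Fin T → Z) → ℝ}

/-- The infimum over `X` of a continuous function. -/
noncomputable def infValue (h : C(X, ℝ)) : ℝ := ⨅ x, h x

theorem bddBelow_range_continuousMap (h : C(X, ℝ)) : BddBelow (Set.range h) :=
  (isCompact_range h.continuous).bddBelow

theorem infValue_le (h : C(X, ℝ)) (x : X) : infValue h ≤ h x :=
  ciInf_le (bddBelow_range_continuousMap h) x

theorem infValue_le_add [Nonempty X] (h h' : C(X, ℝ)) : infValue h ≤ infValue h' + ‖h - h'‖ := by
  rw [← sub_le_iff_le_add]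
  refine le_ciInf fun x => ?_
  have h1 := infValue_le h x
  have h2 := (le_abs_self _).trans ((h - h').norm_coe_le_norm x)
  simp only [ContinuousMap.sub_apply] at h2
  linarith

theorem lipschitzWith_infValue [Nonempty X] : LipschitzWith 1 (infValue : C(X, ℝ) → ℝ) :=
  LipschitzWith.of_le_add fun h h' => by
    rw [dist_eq_norm]; exact infValue_le_add h h'

theorem abs_infValue_le [Nonempty X] (h : C(X, ℝ)) : |infValue h| ≤ ‖h‖ := by
  have h0 : infValue (0 : C(X, ℝ)) = 0 := by simp [infValue]
  have := lipschitzWith_infValue.dist_le_mul h 0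
  simpa [h0, Real.dist_eq] using this

theorem lossLipschitz_neg_infValue_sum [Nonempty X] (k : Z → C(X, ℝ)) :
    LossLipschitz k fun z : Fin T → Z => -infValue (∑ t, k (z t)) := fun z w => by
  have h1 := infValue_le_add (∑ t, k (w t)) (∑ t, k (z t))
  have h2 : ‖∑ t, k (w t) - ∑ t, k (z t)‖ ≤ ∑ t, ‖k (z t) - k (w t)‖ := by
    rw [← Finset.sum_sub_distrib]
    exact (norm_sum_le _ _).trans_eq (Finset.sum_congr rfl fun t _ => norm_sub_rev _ _)
  linarith

/-- Moving `y` to a nearby net point costs at most `δ` in the loss and `δ` in `ψ`, so the supremum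
over `Z` exceeds the maximum over the net by at most `2 * δ`; the finite minimax theorem then
applies. -/
theorem exists_mixed_move [Nonempty Z] [Nonempty X]
    (hk : ∀ x y : X, ∀ a b : ℝ, 0 ≤ a → 0 ≤ b → a + b = 1 →
      ∃ w, ∀ z, k z w ≤ a * k z x + b * k z y)
    (hψ : LossLipschitz k ψ) (hC : ∀ z, ‖k z‖ ≤ C) {ι : Type*} [Fintype ι] [Nonempty ι] (e : ι → Z)
    {δ : ℝ} (hδ : ∀ z, ∃ i, ‖k z - k (e i)‖ ≤ δ) (t : Fin T) (z : Fin T → Z) :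
    ∃ q ∈ stdSimplex ℝ ι, roundValue k t ψ z ≤
      infValue (∑ i, q i • k (e i)) + ∑ i, q i * ψ (update z t (e i)) + 2 * δ := by
  obtain ⟨q, hq, h⟩ := exists_stdSimplex_ciInf_le
    (fun i x => k (e i) x + ψ (update z t (e i))) (fun x y a b ha hb hab => by
      obtain ⟨w, hw⟩ := hk x y a b ha hb hab
      refine ⟨w, fun i => ?_⟩
      have : ψ (update z t (e i)) = (a + b) * ψ (update z t (e i)) := by rw [hab, one_mul]
      have := hw (e i)
      linarith) (roundValue k t ψ z - 2 * δ) (fun x => by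
      obtain ⟨i, hi⟩ := Finite.exists_max fun i => k (e i) x + ψ (update z t (e i))
      refine ⟨i, ?_⟩
      rw [sub_le_iff_le_add]
      refine (roundValue_le_roundSup hψ hC t x z).trans (ciSup_le fun y => ?_)
      obtain ⟨j, hj⟩ := hδ y
      have h1 := hi j
      have h2 := (le_abs_self _).trans ((k y - k (e j)).norm_coe_le_norm x)
      simp only [ContinuousMap.sub_apply] at h2
      have h3 := hψ (update z t y) (update z t (e j))
      rw [sum_norm_update_sub_update_eq] at h3
      linarith)
  refine ⟨q, hq, ?_⟩
  rw [← sub_le_iff_le_add, ← sub_le_iff_le_add]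
  refine le_ciInf fun x => ?_
  have h1 := h x
  simp only [mul_add, Finset.sum_add_distrib] at h1
  simp only [ContinuousMap.coe_sum, ContinuousMap.coe_smul, Finset.sum_apply, Pi.smul_apply,
    smul_eq_mul]
  linarith

end Minimax

/-! ### Measurability for the product σ-algebra and for the past -/

section Measurability

variable {Z X : Type*} [TopologicalSpace X] [CompactSpace X] {T : ℕ}
variable {k : Z → C(X, ℝ)} {ψ : (Fin T → Z) → ℝ}

/-- The Borel σ-algebra of `Z^T` can be larger than the product one, so continuity on `Z^T` would
not suffice. But `ψ` factors through the range of `k`, a compact metric space, where the two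
σ-algebras agree. The section `σ` need not be measurable, since `ψ` depends only on the losses. -/
theorem LossLipschitz.measurable [TopologicalSpace Z] [CompactSpace Z] [MeasurableSpace Z]
    [BorelSpace Z] (hk : Continuous k) (hψ : LossLipschitz k ψ) : Measurable ψ := by
  let K := Set.range k
  have : CompactSpace K := isCompact_iff_compactSpace.1 (isCompact_range hk)
  borelize ↥K
  let r : Z → K := Set.rangeFactorization k
  have hr : Continuous r := hk.subtype_mk _
  have hrs : Function.Surjective r := Set.rangeFactorization_surjective
  let σ := Function.surjInv hrs
  have hσ : ∀ x, k (σ x) = x := fun x => congrArg Subtype.val (Function.surjInv_eq hrs x)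
  let Ψ : (Fin T → K) → ℝ := fun x => ψ fun t => σ (x t)
  have hΨ : Continuous Ψ := by
    refine (LipschitzWith.of_le_add_mul (T : NNReal) fun x y => ?_).continuous
    refine (hψ _ _).trans (add_le_add le_rfl ?_)
    calc ∑ t, ‖k (σ (x t)) - k (σ (y t))‖ ≤ ∑ _t : Fin T, dist x y := by
          refine Finset.sum_le_sum fun t _ => ?_
          rw [hσ, hσ, ← dist_eq_norm]
          exact dist_le_pi_dist x y t
      _ = _ := by simp
  have hfac : ψ = Ψ ∘ fun z t => r (z t) := by
    ext z
    have hz : ∑ t, ‖k (z t) - k (σ (r (z t)))‖ = 0 :=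
      Finset.sum_eq_zero fun t _ => by rw [hσ]; simp [r]
    have hz' : ∑ t, ‖k (σ (r (z t))) - k (z t)‖ = 0 :=
      Finset.sum_eq_zero fun t _ => by rw [hσ]; simp [r]
    have h1 := hψ z fun t => σ (r (z t))
    have h2 := hψ (fun t => σ (r (z t))) z
    rw [hz] at h1
    rw [hz'] at h2
    simp only [Function.comp_apply, Ψ]
    linarith
  rw [hfac]
  exact hΨ.measurable.comp
    (measurable_pi_lambda _ fun t => hr.measurable.comp (measurable_pi_apply t))

open Function in
/-- A measurable function that is determined by the moves before round `t` is measurable for the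
past of round `t`. -/
theorem measurable_pastSigma_of_update [MeasurableSpace Z] [Nonempty Z] {g : (Fin T → Z) → ℝ}
    (hg : Measurable g) (t : Fin T) (hgt : ∀ s, t ≤ s → ∀ z y, g (update z s y) = g z) :
    Measurable[pastSigma Z t] g := by
  obtain ⟨y⟩ := ‹Nonempty Z›
  -- Completing a past by the default move `y` does not change `g`, so `g` factors measurably
  -- through the past.
  let e : (Set.Iio t → Z) → Fin T → Z := fun u s => if h : s < t then u ⟨s, h⟩ else y
  have he : Measurable e := by
    refine measurable_pi_lambda _ fun s => ?_
    by_cases h : s < t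
    · simpa [e, h] using measurable_pi_apply _
    · simp [e, h]
  have hfac : g = (g ∘ e) ∘ fun (z : Fin T → Z) (i : Set.Iio t) => z i := by
    ext z
    refine eq_of_forall_update_eq (p := fun s => t ≤ s) hgt fun s hs => ?_
    simp [e, not_le.1 hs]
  rw [hfac]
  exact (hg.comp he).comp (comap_measurable _)

theorem pastSigma_le [MeasurableSpace Z] (t : Fin T) :
    pastSigma Z t ≤ (inferInstance : MeasurableSpace (Fin T → Z)) :=
  Measurable.comap_le (by fun_prop)

theorem sum_castSucc_sub_succ {G : Type*} [AddCommGroup G] (a : Fin (T + 1) → G) :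
    ∑ t : Fin T, (a t.castSucc - a t.succ) = a 0 - a (Fin.last T) := by
  rw [Finset.sum_sub_distrib, sub_eq_sub_iff_add_eq_add, add_comm (a 0),
    ← Fin.sum_univ_castSucc a, Fin.sum_univ_succ, add_comm]

end Measurability

/-! ### Finite nets and measurable choice from a countable cover -/

section Approximation

theorem exists_finset_dist_lt {A B : Type*} [TopologicalSpace A] [CompactSpace A]
    [PseudoMetricSpace B] {f : A → B} (hf : Continuous f) {ε : ℝ} (hε : 0 < ε) :
    ∃ s : Finset A, ∀ a, ∃ b ∈ s, dist (f a) (f b) < ε := by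
  obtain ⟨s, hs⟩ := CompactSpace.elim_nhds_subcover (fun b => {a | dist (f a) (f b) < ε})
    fun b => (isOpen_lt (hf.dist continuous_const) continuous_const).mem_nhds (by simpa using hε)
  refine ⟨s, fun a => ?_⟩
  have ha : a ∈ ⋃ b ∈ s, {a | dist (f a) (f b) < ε} := hs ▸ trivial
  simpa using ha

theorem exists_measurable_selection {Z ι : Type*} [MeasurableSpace Z] [Countable ι]
    [MeasurableSpace ι] {U : ι → Set Z} (hU : ∀ i, MeasurableSet (U i))
    (hcov : ∀ z, ∃ i, z ∈ U i) : ∃ r : Z → ι, Measurable r ∧ ∀ z, z ∈ U (r z) := by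
  classical
  rcases isEmpty_or_nonempty Z with h | ⟨⟨z₀⟩⟩
  · exact ⟨fun z => h.elim z, measurable_of_empty _, fun z => h.elim z⟩
  · obtain ⟨i₀, -⟩ := hcov z₀
    have : Nonempty ι := ⟨i₀⟩
    obtain ⟨f, hf⟩ := exists_surjective_nat ι
    have hp : ∀ z, ∃ n, z ∈ U (f n) := fun z => by
      obtain ⟨i, hi⟩ := hcov z
      obtain ⟨n, rfl⟩ := hf i
      exact ⟨n, hi⟩
    exact ⟨fun z => f (Nat.find (hp z)),
      measurable_from_nat.comp (measurable_find hp fun n => hU (f n)),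
      fun z => Nat.find_spec (hp z)⟩

end Approximation

/-! ### No law exceeds the value of the game -/

section UpperBound

open Function

variable {Z X : Type*} [TopologicalSpace X] [CompactSpace X] {T : ℕ}
variable [TopologicalSpace Z] [CompactSpace Z] [MeasurableSpace Z] [BorelSpace Z]
variable {k : Z → C(X, ℝ)} {C : ℝ} {φ ψ : (Fin T → Z) → ℝ}

theorem Continuous.stronglyMeasurable_of_compactSpace (hk : Continuous k) :
    StronglyMeasurable k := by
  borelize C(X, ℝ)
  exact stronglyMeasurable_iff_measurable_separable.2
    ⟨hk.measurable, (isCompact_range hk).isSeparable⟩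

theorem integrable_comp_eval (hk : Continuous k) (hC : ∀ z, ‖k z‖ ≤ C)
    (p : Measure (Fin T → Z)) [IsProbabilityMeasure p] (t : Fin T) :
    Integrable (fun z => k (z t)) p :=
  .of_bound (hk.stronglyMeasurable_of_compactSpace.comp_measurable
    (measurable_pi_apply t)).aestronglyMeasurable C (ae_of_all _ fun _ => hC _)

theorem LossLipschitz.integrable [Nonempty Z] (hψ : LossLipschitz k ψ) (hk : Continuous k)
    (hC : ∀ z, ‖k z‖ ≤ C) (p : Measure (Fin T → Z)) [IsProbabilityMeasure p] :
    Integrable ψ p := by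
  obtain ⟨B, hB⟩ := hψ.exists_bound hC
  exact .of_bound (hψ.measurable hk).aestronglyMeasurable B (ae_of_all _ hB)

theorem MeasureTheory.Integrable.infValue [Nonempty X] {Ω : Type*} [MeasurableSpace Ω]
    {p : Measure Ω} {h : Ω → C(X, ℝ)} (hh : Integrable h p) :
    Integrable (fun z => infValue (h z)) p :=
  hh.norm.mono' (lipschitzWith_infValue.continuous.comp_aestronglyMeasurable hh.1)
    (ae_of_all _ fun z => abs_infValue_le (h z))

/-- For fixed `x`, `k (z t) x + ψ z ≤ roundSup k t ψ x z`, and the right side is known from the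
past; condition on the past and integrate. The exceptional null set depends on `x`, so the
inequality is first taken on a finite net of `X`, at the cost of `ε`. -/
theorem integral_infValue_condExp_add_le [Nonempty Z] [Nonempty X] (hk : Continuous k)
    (hC : ∀ z, ‖k z‖ ≤ C) (hψ : LossLipschitz k ψ) (t : Fin T)
    (hψt : ∀ s, t < s → ∀ z y, ψ (update z s y) = ψ z)
    (p : Measure (Fin T → Z)) [IsProbabilityMeasure p] :
    ∫ z, infValue ((p[fun z => k (z t) | pastSigma Z t]) z) ∂p + ∫ z, ψ z ∂p ≤
      ∫ z, roundValue k t ψ z ∂p := by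
  refine le_of_forall_pos_le_add fun ε hε => ?_
  -- Viewing `x` as a function on `Z` makes the net `D` work uniformly over all moves.
  let kX : X → C(Z, ℝ) := fun x => ⟨fun y => k y x, by fun_prop⟩
  have hkX : Continuous kX := ContinuousMap.continuous_of_continuous_uncurry _ (by
    change Continuous fun q : X × Z => k q.2 q.1
    fun_prop)
  obtain ⟨D, hD⟩ := exists_finset_dist_lt hkX hε
  have hint := integrable_comp_eval hk hC p t
  have hψi := hψ.integrable hk hC p
  have hx : ∀ x, ∀ᵐ z ∂p, (p[fun z => k (z t) | pastSigma Z t]) z x +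
      (p[ψ | pastSigma Z t]) z ≤ roundSup k t ψ x z := fun x => by
    have hG := hψ.roundSup hC t x
    have hGm : Measurable[pastSigma Z t] (roundSup k t ψ x) :=
      measurable_pastSigma_of_update (hG.measurable hk) t fun s hs z y =>
        roundSup_update k t x (fun h => hψt s h) hs z y
    have hGi := hG.integrable hk hC p
    have hev : Integrable (fun z : Fin T → Z => k (z t) x) p :=
      (ContinuousMap.evalCLM ℝ x).integrable_comp hint
    have h1 := condExp_mono (m := pastSigma Z t) (hev.add hψi) hGi (ae_of_all _ fun z => by
      have := le_roundSup hψ hC t x z (z t)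
      rwa [update_eq_self] at this)
    have h2 := (ContinuousMap.evalCLM ℝ x).comp_condExp_comm (m := pastSigma Z t) hint
    have h3 := condExp_add hev hψi (pastSigma Z t)
    rw [condExp_of_stronglyMeasurable (pastSigma_le t) hGm.stronglyMeasurable hGi] at h1
    filter_upwards [h1, h2, h3] with z h1 h2 h3
    rw [h3] at h1
    simp only [Pi.add_apply] at h1
    have h2' : (p[fun z => k (z t) | pastSigma Z t]) z x =
      (p[fun z => k (z t) x | pastSigma Z t]) z := h2
    rwa [h2']
  have hae : ∀ᵐ z ∂p, ∀ x ∈ D, (p[fun z => k (z t) | pastSigma Z t]) z x +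
      (p[ψ | pastSigma Z t]) z ≤ roundSup k t ψ x z :=
    (Filter.eventually_all_finset D).2 fun x _ => hx x
  have hV := (hψ.roundValue hC t).integrable hk hC p
  have hI := (integrable_condExp (f := fun z => k (z t)) (m := pastSigma Z t) (μ := p)).infValue
  have hle : ∫ z, (infValue ((p[fun z => k (z t) | pastSigma Z t]) z) +
      (p[ψ | pastSigma Z t]) z) ∂p ≤ ∫ z, (roundValue k t ψ z + ε) ∂p := by
    refine integral_mono_ae (hI.add integrable_condExp) (hV.add (integrable_const _)) ?_
    filter_upwards [hae] with z hz
    rw [← sub_le_iff_le_add]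
    refine le_ciInf fun x => ?_
    obtain ⟨x', hx', hd⟩ := hD x
    have h1 := hz x' hx'
    have h2 := infValue_le ((p[fun z => k (z t) | pastSigma Z t]) z) x'
    have h3 : roundSup k t ψ x' z ≤ roundSup k t ψ x z + ε := ciSup_le fun y => by
      have h4 := le_roundSup hψ hC t x z y
      have h5 : |k y x - k y x'| ≤ ε :=
        (ContinuousMap.dist_apply_le_dist (f := kX x) (g := kX x') y).trans hd.le
      have h6 := neg_le_of_abs_le h5
      linarith
    linarith
  rw [integral_add hI integrable_condExp, integral_condExp (pastSigma_le t),
    integral_add hV (integrable_const _)] at hle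
  simpa using hle

theorem sum_integral_infValue_condExp_add_le [Nonempty Z] [Nonempty X] (hk : Continuous k)
    (hC : ∀ z, ‖k z‖ ≤ C) (hφ : LossLipschitz k φ)
    (p : Measure (Fin T → Z)) [IsProbabilityMeasure p] (z₀ : Fin T → Z) :
    ∑ t, ∫ z, infValue ((p[fun z => k (z t) | pastSigma Z t]) z) ∂p + ∫ z, φ z ∂p ≤
      continuationValue k φ 0 z₀ := by
  have h0 : ∀ z, continuationValue k φ 0 z = continuationValue k φ 0 z₀ := fun z =>
    eq_of_forall_update_eq (p := fun _ => True)
      (fun s _ => continuationValue_update k φ 0 s (Fin.zero_le _)) (by simp)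
  have hsum := sum_castSucc_sub_succ fun i => ∫ z, continuationValue k φ i z ∂p
  simp only [h0, integral_const, probReal_univ, one_smul, continuationValue_last] at hsum
  rw [← le_sub_iff_add_le, ← hsum]
  refine Finset.sum_le_sum fun t _ => ?_
  rw [le_sub_iff_add_le, continuationValue_castSucc]
  exact integral_infValue_condExp_add_le hk hC (hφ.continuationValue hC _) t
    (fun s hs => continuationValue_update k φ _ s (Fin.succ_le_castSucc_iff.2 hs)) p

end UpperBound

/-! ### A nearly optimal law, built round by round -/

section LowerBound

open Function

variable {Z X : Type*} [TopologicalSpace X] [CompactSpace X] {T : ℕ} {ι : Type*} [Fintype ι]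
variable [MeasurableSpace Z]

/-- Redraw the move of round `t` from the points `e i` with the probabilities `q z i`. -/
noncomputable def redraw (e : ι → Z) (q : (Fin T → Z) → ι → ℝ) (t : Fin T)
    (ν : Measure (Fin T → Z)) : Measure (Fin T → Z) :=
  ∑ i, (ν.withDensity fun z => ENNReal.ofReal (q z i)).map fun z => update z t (e i)

/-- The law of the moves after the rounds before `i`, if round `t` is played by `q t`. -/
noncomputable def playLaw (e : ι → Z) (q : Fin T → (Fin T → Z) → ι → ℝ) (z₀ : Fin T → Z) :
    Fin (T + 1) → Measure (Fin T → Z) :=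
  Fin.induction (Measure.dirac z₀) fun t ν => redraw e (q t) t ν

@[simp]
theorem playLaw_zero (e : ι → Z) (q : Fin T → (Fin T → Z) → ι → ℝ) (z₀ : Fin T → Z) :
    playLaw e q z₀ 0 = Measure.dirac z₀ := rfl

@[simp]
theorem playLaw_succ (e : ι → Z) (q : Fin T → (Fin T → Z) → ι → ℝ) (z₀ : Fin T → Z) (t : Fin T) :
    playLaw e q z₀ t.succ = redraw e (q t) t (playLaw e q z₀ t.castSucc) := by
  simp [playLaw]

theorem measurable_update_const (t : Fin T) (y : Z) :
    Measurable fun z : Fin T → Z => update z t y := by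
  refine measurable_pi_lambda _ fun s => ?_
  rcases eq_or_ne s t with rfl | h
  · simp
  · simpa [h] using measurable_pi_apply s

theorem isProbabilityMeasure_redraw (e : ι → Z) {q : (Fin T → Z) → ι → ℝ} (hqm : Measurable q)
    (hq : ∀ z, q z ∈ stdSimplex ℝ ι) (t : Fin T) (ν : Measure (Fin T → Z))
    [IsProbabilityMeasure ν] : IsProbabilityMeasure (redraw e q t ν) := by
  constructor
  have hm : ∀ i, Measurable fun z => ENNReal.ofReal (q z i) := fun i =>
    ((measurable_pi_apply i).comp hqm).ennreal_ofReal
  have h1 : ∀ z, ∑ i, ENNReal.ofReal (q z i) = 1 := fun z => by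
    rw [← ENNReal.ofReal_sum_of_nonneg fun i _ => (hq z).1 i, (hq z).2, ENNReal.ofReal_one]
  simp only [redraw, Measure.finsetSum_apply]
  simp only [Measure.map_apply (measurable_update_const t _) MeasurableSet.univ, Set.preimage_univ,
    withDensity_apply _ MeasurableSet.univ, Measure.restrict_univ]
  rw [← lintegral_finsetSum _ fun i _ => hm i]
  simp [h1]

theorem isProbabilityMeasure_playLaw (e : ι → Z) {q : Fin T → (Fin T → Z) → ι → ℝ}
    (hqm : ∀ t, Measurable (q t)) (hq : ∀ t z, q t z ∈ stdSimplex ℝ ι) (z₀ : Fin T → Z)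
    (i : Fin (T + 1)) : IsProbabilityMeasure (playLaw e q z₀ i) := by
  induction i using Fin.induction with
  | zero => rw [playLaw_zero]; infer_instance
  | succ t ih => rw [playLaw_succ]; exact isProbabilityMeasure_redraw e (hqm t) (hq t) t _

theorem integral_redraw {B : Type*} [NormedAddCommGroup B] [NormedSpace ℝ B] (e : ι → Z)
    {q : (Fin T → Z) → ι → ℝ} (hqm : Measurable q) (hq : ∀ z, q z ∈ stdSimplex ℝ ι) (t : Fin T)
    (ν : Measure (Fin T → Z)) [IsProbabilityMeasure ν] {g : (Fin T → Z) → B}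
    (hg : StronglyMeasurable g) {R : ℝ} (hR : ∀ z, ‖g z‖ ≤ R) :
    ∫ z, g z ∂(redraw e q t ν) = ∫ z, ∑ i, q z i • g (update z t (e i)) ∂ν := by
  have hqi : ∀ i, Measurable fun z => q z i := fun i => (measurable_pi_apply i).comp hqm
  have hgu : ∀ i, StronglyMeasurable fun z => g (update z t (e i)) := fun i =>
    hg.comp_measurable (measurable_update_const t (e i))
  have hq1 : ∀ z i, ‖q z i‖ ≤ 1 := fun z i => by
    rw [Real.norm_of_nonneg ((hq z).1 i), ← (hq z).2]
    exact Finset.single_le_sum (fun j _ => (hq z).1 j) (Finset.mem_univ i)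
  have hle : ∀ z i, ‖q z i • g (update z t (e i))‖ ≤ R := fun z i => by
    rw [norm_smul]
    have h0 := (norm_nonneg _).trans (hR z)
    calc _ ≤ 1 * R := mul_le_mul (hq1 z i) (hR _) (norm_nonneg _) zero_le_one
      _ = R := one_mul R
  have := isProbabilityMeasure_redraw e hqm hq t ν
  have hgi : Integrable g (redraw e q t ν) := .of_bound hg.aestronglyMeasurable R (ae_of_all _ hR)
  have hi : ∀ i, Integrable (fun z => q z i • g (update z t (e i))) ν := fun i =>
    .of_bound ((hqi i).stronglyMeasurable.smul (hgu i)).aestronglyMeasurable R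
      (ae_of_all _ fun z => hle z i)
  rw [redraw] at hgi ⊢
  rw [integral_finsetSum_measure (integrable_finsetSum_measure.1 hgi),
    integral_finsetSum _ fun i _ => hi i]
  refine Finset.sum_congr rfl fun i _ => ?_
  rw [integral_map (measurable_update_const t _).aemeasurable hg.aestronglyMeasurable,
    integral_withDensity_eq_integral_toReal_smul (hqi i).ennreal_ofReal
      (ae_of_all _ fun _ => ENNReal.ofReal_lt_top)]
  simp [ENNReal.toReal_ofReal ((hq _).1 i)]

/-- Redrawing a coordinate that `g` ignores changes nothing, because the weights sum to one. -/
theorem integral_playLaw_last {B : Type*} [NormedAddCommGroup B] [NormedSpace ℝ B] (e : ι → Z)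
    {q : Fin T → (Fin T → Z) → ι → ℝ} (hqm : ∀ t, Measurable (q t))
    (hq : ∀ t z, q t z ∈ stdSimplex ℝ ι) (z₀ : Fin T → Z) {g : (Fin T → Z) → B}
    (hg : StronglyMeasurable g) {R : ℝ} (hR : ∀ z, ‖g z‖ ≤ R) (i : Fin (T + 1))
    (hgi : ∀ s : Fin T, i ≤ s.castSucc → ∀ z y, g (update z s y) = g z) :
    ∫ z, g z ∂(playLaw e q z₀ (Fin.last T)) = ∫ z, g z ∂(playLaw e q z₀ i) := by
  induction i using Fin.reverseInduction with
  | last => rfl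
  | cast t ih =>
    have := isProbabilityMeasure_playLaw e hqm hq z₀ t.castSucc
    rw [ih fun s hs => hgi s ((Fin.castSucc_lt_succ).le.trans hs), playLaw_succ,
      integral_redraw e (hqm t) (hq t) t _ hg hR]
    simp only [hgi t le_rfl, ← Finset.sum_smul, (hq t _).2, one_smul]

theorem update_mem_iff_of_pastSigma {t : Fin T} {A : Set (Fin T → Z)}
    (hA : MeasurableSet[pastSigma Z t] A) {s : Fin T} (hs : t ≤ s) (z : Fin T → Z) (y : Z) :
    update z s y ∈ A ↔ z ∈ A := by
  obtain ⟨A', -, rfl⟩ := hA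
  have : (fun i : Set.Iio t => update z s y i) = fun i : Set.Iio t => z i := by
    ext i
    rw [update_of_ne]
    exact (lt_of_lt_of_le i.2 hs).ne
  simp only [Set.mem_preimage, this]

theorem apply_update_of_measurable_pastSigma {B : Type*} [MeasurableSpace B]
    [MeasurableSingletonClass B] {t : Fin T} {g : (Fin T → Z) → B}
    (hg : Measurable[pastSigma Z t] g) {s : Fin T} (hs : t ≤ s) (z : Fin T → Z) (y : Z) :
    g (update z s y) = g z :=
  (update_mem_iff_of_pastSigma (hg (measurableSet_singleton (g z))) hs z y).2 rfl

theorem norm_sum_smul_le_of_stdSimplex {B : Type*} [NormedAddCommGroup B] [NormedSpace ℝ B]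
    {w : ι → ℝ} (hw : w ∈ stdSimplex ℝ ι) {b : ι → B} {R : ℝ} (hb : ∀ i, ‖b i‖ ≤ R) :
    ‖∑ i, w i • b i‖ ≤ R :=
  calc ‖∑ i, w i • b i‖ ≤ ∑ i, w i * R := norm_sum_le_of_le _ fun i _ => by
        rw [norm_smul, Real.norm_of_nonneg (hw.1 i)]
        exact mul_le_mul_of_nonneg_left (hb i) (hw.1 i)
    _ = R := by rw [← Finset.sum_mul, hw.2, one_mul]

variable [TopologicalSpace Z] [BorelSpace Z]
variable {k : Z → C(X, ℝ)} {C : ℝ} {φ ψ : (Fin T → Z) → ℝ}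

/-- Rounding the past measurably to the net leaves finitely many histories, so any choice of mixed
moves is measurable. Rounding costs `T * δ` in the round value and `T * δ` in `ψ`, besides the `2 *
δ` of `exists_mixed_move`. -/
theorem exists_past_strategy [Nonempty Z] [Nonempty X] [Nonempty ι] (hk : Continuous k)
    (hconv : ∀ x y : X, ∀ a b : ℝ, 0 ≤ a → 0 ≤ b → a + b = 1 →
      ∃ w, ∀ z, k z w ≤ a * k z x + b * k z y)
    (hC : ∀ z, ‖k z‖ ≤ C) (e : ι → Z) {δ : ℝ} (hδ : 0 ≤ δ)
    (he : ∀ z, ∃ i, ‖k z - k (e i)‖ ≤ δ) (hψ : LossLipschitz k ψ) (t : Fin T)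
    (hψt : ∀ s, t < s → ∀ z y, ψ (update z s y) = ψ z) :
    ∃ q : (Fin T → Z) → ι → ℝ, Measurable[pastSigma Z t] q ∧ (∀ z, q z ∈ stdSimplex ℝ ι) ∧
      ∀ z, roundValue k t ψ z ≤ infValue (∑ i, q z i • k (e i)) +
        ∑ i, q z i * ψ (update z t (e i)) + (2 * T + 2) * δ := by
  let _ : MeasurableSpace ι := ⊤
  have : DiscreteMeasurableSpace ι := ⟨fun _ => trivial⟩
  obtain ⟨r, hrm, hr⟩ := exists_measurable_selection (U := fun i => {z | ‖k z - k (e i)‖ ≤ δ})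
    (fun i => (isClosed_le (by fun_prop) continuous_const).measurableSet) he
  choose Q hQ hQle using exists_mixed_move (T := T) hconv hψ hC e he t
  obtain ⟨y₀⟩ := ‹Nonempty Z›
  let J : (Set.Iio t → ι) → Fin T → Z := fun u s => if h : s < t then e (u ⟨s, h⟩) else y₀
  let ρ : (Fin T → Z) → Set.Iio t → ι := fun z s => r (z s)
  have hρ : Measurable[pastSigma Z t] ρ := by
    have h1 : Measurable fun (u : Set.Iio t → Z) s => r (u s) := by fun_prop
    exact h1.comp (comap_measurable fun (z : Fin T → Z) (i : Set.Iio t) => z i)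
  have hQJ : Measurable fun u => Q (J u) := Measurable.of_discrete
  refine ⟨fun z => Q (J (ρ z)), hQJ.comp hρ, fun z => hQ _, fun z => ?_⟩
  -- `z'` has the past of `z` and is close to the rounded sequence
  let z' : Fin T → Z := fun s => if s < t then z s else y₀
  have hD : ∑ s, ‖k (z' s) - k (J (ρ z) s)‖ ≤ T * δ := by
    calc ∑ s, ‖k (z' s) - k (J (ρ z) s)‖ ≤ ∑ _s : Fin T, δ := by
          refine Finset.sum_le_sum fun s _ => ?_
          by_cases h : s < t
          · simpa [z', J, ρ, h] using hr (z s)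
          · simpa [z', J, h] using hδ
      _ = T * δ := by simp
  have hD' : ∑ s, ‖k (J (ρ z) s) - k (z' s)‖ ≤ T * δ := by simpa only [norm_sub_rev] using hD
  have h1 : roundValue k t ψ z = roundValue k t ψ z' :=
    eq_of_forall_update_eq (g := roundValue k t ψ) (p := fun s => t ≤ s) (fun s hs w y =>
      iInf_congr fun x => roundSup_update k t x (fun h => hψt s h) hs w y)
      fun s hs => by simp [z', not_le.1 hs]
  have h2 : ∀ i, ψ (update z t (e i)) = ψ (update z' t (e i)) := fun i =>
    eq_of_forall_update_eq (p := fun s => t < s) hψt fun s hs => by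
      rcases (not_lt.1 hs).eq_or_lt with rfl | h
      · simp
      · simp [z', h, h.ne]
  have h3 := (hψ.roundValue hC t) z' (J (ρ z))
  have h4 := hQle (J (ρ z))
  have h5 : ∑ i, Q (J (ρ z)) i * ψ (update (J (ρ z)) t (e i)) ≤
      ∑ i, Q (J (ρ z)) i * ψ (update z t (e i)) + T * δ := by
    have : (T : ℝ) * δ = ∑ i, Q (J (ρ z)) i * (T * δ) := by
      rw [← Finset.sum_mul, (hQ _).2, one_mul]
    rw [this, ← Finset.sum_add_distrib]
    refine Finset.sum_le_sum fun i _ => ?_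
    rw [← mul_add, h2]
    refine mul_le_mul_of_nonneg_left ?_ ((hQ _).1 i)
    have h6 := hψ (update (J (ρ z)) t (e i)) (update z' t (e i))
    have h7 := sum_norm_update_sub_update_le k (J (ρ z)) z' t (e i)
    linarith
  rw [h1]
  linarith

variable [CompactSpace Z]

/-- Test against an event `A` of the past. Later redraws do not affect either integral, so both
reduce to the law just before round `t`, through a single redraw on the side of `k (z t)`; that
redraw leaves membership in `A` unchanged. -/
theorem condExp_playLaw (hk : Continuous k) (hC : ∀ z, ‖k z‖ ≤ C) (e : ι → Z)
    {q : Fin T → (Fin T → Z) → ι → ℝ} (hqm : ∀ t, Measurable[pastSigma Z t] (q t))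
    (hq : ∀ t z, q t z ∈ stdSimplex ℝ ι) (z₀ : Fin T → Z) (t : Fin T) :
    (fun z => ∑ i, q t z i • k (e i)) =ᵐ[playLaw e q z₀ (Fin.last T)]
      (playLaw e q z₀ (Fin.last T))[fun z => k (z t) | pastSigma Z t] := by
  have hqm' : ∀ t, Measurable (q t) := fun t => (hqm t).mono (pastSigma_le t) le_rfl
  have hprob := isProbabilityMeasure_playLaw e hqm' hq z₀
  have hcm : StronglyMeasurable[pastSigma Z t] fun z => ∑ i, q t z i • k (e i) :=
    Finset.stronglyMeasurable_fun_sum _ fun i _ =>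
      (((measurable_pi_apply i).comp (hqm t)).stronglyMeasurable).smul_const _
  have hcb : ∀ z, ‖∑ i, q t z i • k (e i)‖ ≤ C := fun z =>
    norm_sum_smul_le_of_stdSimplex (hq t z) fun i => hC _
  have hkm : StronglyMeasurable fun z : Fin T → Z => k (z t) :=
    hk.stronglyMeasurable_of_compactSpace.comp_measurable (measurable_pi_apply t)
  refine ae_eq_condExp_of_forall_setIntegral_eq (pastSigma_le t)
    (integrable_comp_eval hk hC _ t) (fun A _ _ => (Integrable.of_bound
      (hcm.mono (pastSigma_le t)).aestronglyMeasurable C (ae_of_all _ hcb)).integrableOn)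
    (fun A hA _ => ?_) hcm.aestronglyMeasurable
  have hA' := pastSigma_le t A hA
  have hb : ∀ {f : (Fin T → Z) → C(X, ℝ)}, (∀ z, ‖f z‖ ≤ C) → ∀ z, ‖A.indicator f z‖ ≤ C :=
    fun h z => (norm_indicator_le_norm_self _ _).trans (h z)
  rw [← integral_indicator hA', ← integral_indicator hA',
    integral_playLaw_last e hqm' hq z₀ ((hcm.mono (pastSigma_le t)).indicator hA') (hb hcb)
      t.castSucc fun s hs z y => ?_,
    integral_playLaw_last e hqm' hq z₀ (hkm.indicator hA') (hb fun z => hC (z t))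
      t.succ fun s hs z y => ?_,
    playLaw_succ, integral_redraw e (hqm' t) (hq t) t _ (hkm.indicator hA')
      (hb fun z => hC (z t))]
  · refine integral_congr_ae (ae_of_all _ fun z => ?_)
    by_cases hz : z ∈ A
    · simp [hz, update_mem_iff_of_pastSigma hA le_rfl, Set.indicator]
    · simp [hz, update_mem_iff_of_pastSigma hA le_rfl, Set.indicator]
  · have hts : t < s := Fin.succ_le_castSucc_iff.1 hs
    have hA_iff := update_mem_iff_of_pastSigma hA hts.le z y
    by_cases hz : z ∈ A <;> simp [hA_iff, hz, hts.ne]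
  · have hts : t ≤ s := Fin.castSucc_le_castSucc_iff.1 hs
    have hA_iff := update_mem_iff_of_pastSigma hA hts z y
    have hq_eq := apply_update_of_measurable_pastSigma (hqm t) hts z y
    by_cases hz : z ∈ A <;> simp [hA_iff, hz, hq_eq]

theorem exists_le_sum_integral_infValue_condExp_add [Nonempty Z] [Nonempty X] (hk : Continuous k)
    (hconv : ∀ x y : X, ∀ a b : ℝ, 0 ≤ a → 0 ≤ b → a + b = 1 →
      ∃ w, ∀ z, k z w ≤ a * k z x + b * k z y)
    (hC : ∀ z, ‖k z‖ ≤ C) (hφ : LossLipschitz k φ) (z₀ : Fin T → Z) {ε : ℝ} (hε : 0 < ε) :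
    ∃ p : Measure (Fin T → Z), IsProbabilityMeasure p ∧ continuationValue k φ 0 z₀ ≤
      ∑ t, ∫ z, infValue ((p[fun z => k (z t) | pastSigma Z t]) z) ∂p + ∫ z, φ z ∂p + ε := by
  -- Each of the `T` rounds loses `(2 * T + 2) * δ`; the factor `T + 1` instead of `T` keeps the
  -- denominator positive when `T = 0`.
  let δ : ℝ := ε / ((T + 1) * (2 * T + 2))
  have hδ : 0 < δ := by positivity
  obtain ⟨S, hS⟩ := exists_finset_dist_lt hk hδ
  let e : S → Z := Subtype.val
  have he : ∀ z, ∃ i, ‖k z - k (e i)‖ ≤ δ := fun z => by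
    obtain ⟨b, hb, h⟩ := hS z
    exact ⟨⟨b, hb⟩, by rw [← dist_eq_norm]; exact h.le⟩
  have : Nonempty S := by
    obtain ⟨y⟩ := ‹Nonempty Z›
    exact ⟨(he y).choose⟩
  have hW := hφ.continuationValue hC
  choose q hqm hq hle using fun t : Fin T => exists_past_strategy hk hconv hC e hδ.le he
    (hW t.succ) t
    fun s hs => continuationValue_update k φ _ s (Fin.succ_le_castSucc_iff.2 hs)
  have hqm' : ∀ t, Measurable (q t) := fun t => (hqm t).mono (pastSigma_le t) le_rfl
  have hprob := isProbabilityMeasure_playLaw e hqm' hq z₀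
  have hcm : ∀ t, Measurable fun z => infValue (∑ i, q t z i • k (e i)) := fun t => by
    refine (lipschitzWith_infValue.continuous.comp_stronglyMeasurable
      (Finset.stronglyMeasurable_fun_sum _ fun i _ => ?_)).measurable
    exact (((measurable_pi_apply i).comp (hqm' t)).stronglyMeasurable).smul_const _
  have hcb : ∀ t z, |infValue (∑ i, q t z i • k (e i))| ≤ C := fun t z =>
    (abs_infValue_le _).trans (norm_sum_smul_le_of_stdSimplex (hq t z) fun i => hC _)
  refine ⟨playLaw e q z₀ (Fin.last T), hprob _, ?_⟩
  have hstep : ∀ t : Fin T,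
      ∫ z, continuationValue k φ t.castSucc z ∂(playLaw e q z₀ t.castSucc) -
        ∫ z, continuationValue k φ t.succ z ∂(playLaw e q z₀ t.succ) ≤
      ∫ z, infValue (((playLaw e q z₀ (Fin.last T))[fun z => k (z t) | pastSigma Z t]) z)
        ∂(playLaw e q z₀ (Fin.last T)) + (2 * T + 2) * δ := fun t => by
    obtain ⟨R, hR⟩ := (hW t.succ).exists_bound hC
    have hWm := (hW t.succ).measurable hk
    have h1 : ∫ z, infValue (((playLaw e q z₀ (Fin.last T))[fun z => k (z t) | pastSigma Z t]) z)
        ∂(playLaw e q z₀ (Fin.last T)) =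
        ∫ z, infValue (∑ i, q t z i • k (e i)) ∂(playLaw e q z₀ t.castSucc) := by
      rw [← integral_playLaw_last e hqm' hq z₀ (hcm t).stronglyMeasurable (hcb t) t.castSucc
        fun s hs z y => by
          rw [apply_update_of_measurable_pastSigma (hqm t) (Fin.castSucc_le_castSucc_iff.1 hs)]]
      refine integral_congr_ae ?_
      filter_upwards [condExp_playLaw hk hC e hqm hq z₀ t] with z hz
      rw [hz]
    rw [h1, sub_le_iff_le_add, playLaw_succ,
      integral_redraw e (hqm' t) (hq t) t _ hWm.stronglyMeasurable hR]
    have hi1 : Integrable (fun z => infValue (∑ i, q t z i • k (e i)))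
        (playLaw e q z₀ t.castSucc) :=
      .of_bound (hcm t).aestronglyMeasurable C (ae_of_all _ (hcb t))
    have hi2 : Integrable (fun z => ∑ i, q t z i • continuationValue k φ t.succ (update z t (e i)))
        (playLaw e q z₀ t.castSucc) := by
      refine .of_bound (Measurable.aestronglyMeasurable ?_) R (ae_of_all _ fun z =>
        norm_sum_smul_le_of_stdSimplex (hq t z) fun i => hR _)
      exact Finset.measurable_fun_sum _ fun i _ => ((measurable_pi_apply i).comp (hqm' t)).smul
        (hWm.comp (measurable_update_const t (e i)))
    calc _ ≤ ∫ z, (infValue (∑ i, q t z i • k (e i)) +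
          ∑ i, q t z i • continuationValue k φ t.succ (update z t (e i)) + (2 * T + 2) * δ)
          ∂(playLaw e q z₀ t.castSucc) := by
          refine integral_mono ((hW _).integrable hk hC _)
            ((hi1.add hi2).add (integrable_const _)) fun z => ?_
          rw [continuationValue_castSucc]
          exact hle t z
      _ = _ := by
          rw [integral_add (f := fun z => _ + _) (hi1.add hi2) (integrable_const _),
            integral_add hi1 hi2]
          simp only [integral_const, probReal_univ, one_smul]
          ring
  -- The sum telescopes from the value at `z₀` to the mean final payoff under the complete law.
  have hsum := Finset.sum_le_sum fun t (_ : t ∈ Finset.univ) => hstep t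
  rw [sum_castSucc_sub_succ fun i => ∫ z, continuationValue k φ i z ∂(playLaw e q z₀ i),
    Finset.sum_add_distrib, playLaw_zero,
    integral_dirac' _ _ ((hW 0).measurable hk).stronglyMeasurable] at hsum
  have hT : ∑ _t : Fin T, (2 * T + 2) * δ ≤ ε := by
    have h : (T + 1) * ((2 * T + 2) * δ) = ε := by
      simp only [δ]; field_simp
    have h' : 0 ≤ (2 * T + 2) * δ := by positivity
    simp only [Finset.sum_const, Finset.card_univ, Fintype.card_fin, nsmul_eq_mul]
    linarith
  simp only [continuationValue_last] at hsum
  linarith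

end LowerBound

/-! ### Translation to regret and conclusion -/

theorem stochasticRegret_eq {Z E : Type*} [TopologicalSpace Z] [MeasurableSpace Z]
    [TopologicalSpace E] {F : Set E} [CompactSpace F] {ℓ : Z → E → ℝ}
    (hℓ : ContinuousOn (Function.uncurry ℓ) (Set.univ ×ˢ F)) {T : ℕ} (p : Measure (Fin T → Z))
    (z : Fin T → Z) :
    stochasticRegret hℓ p z =
      ∑ t, infValue ((p[fun z => lossFun hℓ (z t) | pastSigma Z t]) z) +
        -infValue (∑ t, lossFun hℓ (z t)) := by
  simp [stochasticRegret, conditionalLoss, infValue, lossFun, sub_eq_add_neg]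
  rfl

theorem minimaxRegret_eq_continuationValue {Z E : Type*} [TopologicalSpace Z] [Nonempty Z]
    [TopologicalSpace E] {F : Set E} [CompactSpace F] [Nonempty F] {ℓ : Z → E → ℝ}
    (hℓ : ContinuousOn (Function.uncurry ℓ) (Set.univ ×ˢ F)) {C : ℝ}
    (hC : ∀ z, ‖lossFun hℓ z‖ ≤ C) {T : ℕ} (z₀ : Fin T → Z) :
    minimaxRegret F ℓ T =
      continuationValue (lossFun hℓ) (fun z => -infValue (∑ t, lossFun hℓ (z t))) 0 z₀ := by
  rw [← zero_add (continuationValue _ _ _ _), ← iteratedInfSup_eq_continuationValue hC _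
    (lossLipschitz_neg_infValue_sum _), minimaxRegret]
  congr 1
  ext z f
  simp [regret, infValue, lossFun, sub_eq_add_neg]
  rfl

theorem theorem1 {Z E : Type*}
    [TopologicalSpace Z] [T2Space Z] [CompactSpace Z] [Nonempty Z]
    [MeasurableSpace Z] [BorelSpace Z]
    [AddCommGroup E] [Module ℝ E] [TopologicalSpace E] [IsTopologicalAddGroup E]
    [ContinuousSMul ℝ E]
    (F : Set E) [CompactSpace F] (hF : F.Nonempty) (hFconv : Convex ℝ F)
    (ℓ : Z → E → ℝ) (hℓ : ContinuousOn (Function.uncurry ℓ) (Set.univ ×ˢ F))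
    (hℓconv : ∀ z, ConvexOn ℝ F (ℓ z)) (T : ℕ) :
    (∀ p : ProbabilityMeasure (Fin T → Z),
      Integrable (stochasticRegret hℓ (p : Measure (Fin T → Z))) (p : Measure (Fin T → Z))) ∧
    IsLUB (Set.range fun p : ProbabilityMeasure (Fin T → Z) =>
        ∫ z, stochasticRegret hℓ (p : Measure (Fin T → Z)) z ∂(p : Measure (Fin T → Z)))
      (minimaxRegret F ℓ T) := by
  have : Nonempty F := hF.to_subtype
  have hk := continuous_lossFun hℓ
  obtain ⟨C, hC'⟩ := (isCompact_range hk).isBounded.exists_norm_le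
  have hC : ∀ z, ‖lossFun hℓ z‖ ≤ C := fun z => hC' _ ⟨z, rfl⟩
  have hφ := lossLipschitz_neg_infValue_sum (T := T) (lossFun hℓ)
  -- Convexity of `F` and of the losses enters only here: one point `w` serves all moves `z` at
  -- once.
  have hconv : ∀ x y : F, ∀ a b : ℝ, 0 ≤ a → 0 ≤ b → a + b = 1 →
      ∃ w, ∀ z, lossFun hℓ z w ≤ a * lossFun hℓ z x + b * lossFun hℓ z y :=
    fun x y a b ha hb hab => ⟨⟨a • (x : E) + b • (y : E), hFconv x.2 y.2 ha hb hab⟩,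
      fun z => (hℓconv z).2 x.2 y.2 ha hb hab⟩
  obtain ⟨y⟩ := ‹Nonempty Z›
  have : Nonempty Z := ⟨y⟩
  let z₀ : Fin T → Z := fun _ => y
  have hsumi : ∀ (p : Measure (Fin T → Z)) [IsProbabilityMeasure p], Integrable (fun z =>
      ∑ t, infValue ((p[fun z => lossFun hℓ (z t) | pastSigma Z t]) z)) p := fun p _ =>
    integrable_finsetSum _ fun t _ => integrable_condExp.infValue
  have hint : ∀ (p : Measure (Fin T → Z)) [IsProbabilityMeasure p],
      Integrable (stochasticRegret hℓ p) p := fun p _ => by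
    rw [funext (stochasticRegret_eq hℓ p)]
    exact (hsumi p).add (hφ.integrable hk hC p)
  have heq : ∀ (p : Measure (Fin T → Z)) [IsProbabilityMeasure p],
      ∫ z, stochasticRegret hℓ p z ∂p =
        ∑ t, ∫ z, infValue ((p[fun z => lossFun hℓ (z t) | pastSigma Z t]) z) ∂p +
          ∫ z, -infValue (∑ t, lossFun hℓ (z t)) ∂p := fun p _ => by
    simp only [stochasticRegret_eq hℓ p]
    rw [integral_add (hsumi p) (hφ.integrable hk hC p),
      integral_finsetSum _ fun t _ => integrable_condExp.infValue]
  rw [minimaxRegret_eq_continuationValue hℓ hC z₀]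
  refine ⟨fun p => hint p, ?_, fun b hb => le_of_forall_pos_le_add fun ε hε => ?_⟩
  · rintro _ ⟨p, rfl⟩
    simp only [heq]
    exact sum_integral_infValue_condExp_add_le hk hC hφ p z₀
  · obtain ⟨p, hp, hle⟩ := exists_le_sum_integral_infValue_condExp_add hk hconv hC hφ z₀ hε
    have h := hb ⟨⟨p, hp⟩, rfl⟩
    simp only [ProbabilityMeasure.coe_mk, heq] at h
    linarith
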